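/- **Measurable Gelfand duality.** All C*-algebras and *-homomorphisms are unital. A commutative $\sigma C^*$-algebra is a commutative C*-algebra $A$ in which every norm-bounded monotone increasing sequence of self-adjoint elements has a supremum in $A_{\mathrm{sa}}$. A $\sigma$-homomorphism is a *-homomorphism that preserves all existing suprema of such sequences. Let $\mathsf{Meas}$ be the category of measurable spaces and measurable maps, and $\mathsf{c}\sigma\mathsf{C}^*_\sigma$ the category of commutative $\sigma C^*$-algebras and $\sigma$-homomorphisms. Consider the contravariant functors - $\mathscr L^\infty$ from $\mathsf{Meas}$ to $\mathsf{c}\sigma\mathsf{C}^*_\sigma$, sending $X$ to the algebra of all bounded measurable functions $X\to\mathbb C$ (with pointwise operations and supremum norm) and acting on morphisms by precomposition; - $\mathrm{Spec}_\sigma$ from $\mathsf{c}\sigma\mathsf{C}^*_\sigma$ to $\mathsf{Meas}$, sending $A$ to its Gelfand $\sigma$-spectrum, i.e. the set of $\sigma$-homomorphisms $A\to\mathbb C$ with the smallest $\sigma$-algebra making all evaluations $\phi\mapsto\phi(a)$, $a\in A$, measurable, and acting on morphisms by precomposition. Then $\mathscr L^\infty\colon \mathsf{Meas}\to(\mathsf{c}\sigma\mathsf{C}^*_\sigma)^{\mathrm{op}}$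 is left adjoint to $\mathrm{Spec}_\sigma\colon(\mathsf{c}\sigma\mathsf{C}^*_\sigma)^{\mathrm{op}}\to\mathsf{Meas}$, and the adjunction is idempotent (the multiplication of the induced monad is an isomorphism). Moreover, the adjunction restricts to a dual equivalence between the full subcategory of sober measurable spaces and the full subcategory of purely $\sigma$-representable commutative $\sigma C^*$-algebras: $\mathscr L^\infty$ and $\mathrm{Spec}_\sigma$ map these subcategories into each other, and the unit and counit of the adjunction restrict to natural isomorphisms there. Here - a measurable space $X$ is sober if $X \xrightarrow{\ \delta\ } PX \rightrightarrows PPX$ is an equalizer diagram in $\mathsf{Meas}$, where $P$ is the Giry monad of probability measures, $\delta$ is its unit (delta measures), and the two parallel maps are $\delta_{PX}$ and $P\delta_X$; - $A$ is purely $\sigma$-representable if every $x\ge 0$ in $A$ with $\phi(x)=0$ for all pure $\sigma$-states $\phi$ is $0$, where a pure $\sigma$-state is a state that is extremal in the convex set of all states and preserves all existing suprema of norm-bounded monotone increasing sequences of self-adjoint elements. -/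

import Mathlib

open CategoryTheory MeasureTheory
open scoped ENNReal ComplexOrder

universe u

namespace MeasGelfand

noncomputable section

/-! ### Monotone sequences and suprema in the self-adjoint part of a C*-algebra

Throughout, "C*-algebra" means unital C*-algebra (the zero algebra is allowed). All C*-algebras
below carry `[PartialOrder A] [StarOrderedRing A]`, i.e. their usual order, which is determined by
the `*`-algebra structure: `a ≤ b` iff `b - a` is a positive element. (The first definitions only
mention the order itself.) -/

section Order

variable {A : Type*} [CStarAlgebra A] [PartialOrder A]

/-- `a` is a norm-bounded monotone increasing sequence of self-adjoint elements. -/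
structure IsBddIncreasing (a : ℕ → A) : Prop where
  selfAdjoint : ∀ n, IsSelfAdjoint (a n)
  le_succ : ∀ n, a n ≤ a (n + 1)
  bounded : ∃ C : ℝ, ∀ n, ‖a n‖ ≤ C

/-- `s` is the supremum of the sequence `a` in the poset of self-adjoint elements of `A`. -/
def IsSASup (a : ℕ → A) (s : A) : Prop :=
  IsLeast {t : A | IsSelfAdjoint t ∧ ∀ n, a n ≤ t} s

theorem IsSASup.unique {a : ℕ → A} {s t : A} (hs : IsSASup a s) (ht : IsSASup a t) : s = t :=
  IsLeast.unique hs ht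

variable (A) in
/-- `A` is a `σC*`-algebra, i.e. monotone `σ`-complete: every norm-bounded monotone increasing
sequence of self-adjoint elements has a supremum in the self-adjoint part. -/
def IsSigmaCStar : Prop :=
  ∀ a : ℕ → A, IsBddIncreasing a → ∃ s, IsSASup a s

/-- `φ` is `σ`-normal: it preserves all existing suprema of norm-bounded monotone increasing
sequences. (Used only for positive unital maps `φ`.) -/
def IsSigmaNormal {B : Type*} [CStarAlgebra B] [PartialOrder B]
    (φ : A → B) : Prop :=
  ∀ (a : ℕ → A) (s : A), IsBddIncreasing a → IsSASup a s → IsSASup (fun n => φ (a n)) (φ s)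

variable (A) in
/-- The convex set of states of `A`: positive unital linear functionals. -/
def states : Set (A →ₗ[ℂ] ℂ) :=
  {φ | (∀ x : A, 0 ≤ x → 0 ≤ φ x) ∧ φ 1 = 1}

/-- A pure `σ`-state is a `σ`-normal state which is extremal in the convex set of all states. -/
def IsPureSigmaState (φ : A →ₗ[ℂ] ℂ) : Prop :=
  φ ∈ (states A).extremePoints ℝ ∧ IsSigmaNormal (φ : A → ℂ)

variable (A) in
/-- `A` is purely `σ`-representable if the pure `σ`-states separate its positive elements
from zero. -/
def IsPurelySigmaRepresentable : Prop :=
  ∀ x : A, 0 ≤ x → (∀ φ : A →ₗ[ℂ] ℂ, IsPureSigmaState φ → φ x = 0) → x = 0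

end Order

/-! ### The category of commutative `σC*`-algebras and `σ`-homomorphisms -/

/-- A commutative `σC*`-algebra. -/
structure CSigmaCStar : Type (u + 1) where
  /-- The underlying type. -/
  carrier : Type u
  [commCStar : CommCStarAlgebra carrier]
  [partialOrder : PartialOrder carrier]
  [starOrdered : StarOrderedRing carrier]
  isSigma : IsSigmaCStar carrier

attribute [instance] CSigmaCStar.commCStar CSigmaCStar.partialOrder CSigmaCStar.starOrdered

/-- A `σ`-homomorphism: a `σ`-normal unital `*`-homomorphism. -/
@[ext]
structure SigmaHom (A B : Type*) [CStarAlgebra A] [PartialOrder A] [StarOrderedRing A]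
    [CStarAlgebra B] [PartialOrder B] [StarOrderedRing B] where
  /-- The underlying unital `*`-homomorphism. -/
  toHom : A →⋆ₐ[ℂ] B
  sigmaNormal : IsSigmaNormal (toHom : A → B)

namespace SigmaHom

variable {A B C : Type*} [CStarAlgebra A] [PartialOrder A] [StarOrderedRing A]
  [CStarAlgebra B] [PartialOrder B] [StarOrderedRing B]
  [CStarAlgebra C] [PartialOrder C] [StarOrderedRing C]

theorem map_isBddIncreasing (φ : A →⋆ₐ[ℂ] B) {a : ℕ → A} (ha : IsBddIncreasing a) :
    IsBddIncreasing (fun n => φ (a n)) where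
  selfAdjoint n := (ha.selfAdjoint n).map φ
  le_succ n := OrderHomClass.mono φ (ha.le_succ n)
  bounded := ha.bounded.imp fun _ h n => (NonUnitalStarAlgHom.norm_apply_le φ (a n)).trans (h n)

variable (A) in
/-- The identity `σ`-homomorphism. -/
def id : SigmaHom A A := ⟨StarAlgHom.id ℂ A, fun _ _ _ h => h⟩

/-- Composition of `σ`-homomorphisms. -/
def comp (ψ : SigmaHom B C) (φ : SigmaHom A B) : SigmaHom A C :=
  ⟨ψ.toHom.comp φ.toHom, fun a s ha hs =>
    ψ.sigmaNormal _ _ (map_isBddIncreasing φ.toHom ha) (φ.sigmaNormal a s ha hs)⟩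

end SigmaHom

instance : Category CSigmaCStar.{u} where
  Hom A B := SigmaHom A.carrier B.carrier
  id A := SigmaHom.id A.carrier
  comp f g := g.comp f

/-! ### Bounded measurable functions -/

section Linf

variable (X : Type*) [MeasurableSpace X]

/-- The measurable functions inside the C*-algebra `ℓ^∞(X)` of all bounded functions `X → ℂ`
with pointwise operations and supremum norm, as a unital `*`-subalgebra. -/
def measurableSubalgebra : StarSubalgebra ℂ (lp (fun _ : X => ℂ) ∞) where
  carrier := {f | Measurable (f : X → ℂ)}
  mul_mem' {f g} hf hg := by
    have h : Measurable ((f : X → ℂ) * (g : X → ℂ)) := Measurable.mul hf hg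
    exact h
  add_mem' {f g} hf hg := by
    have h : Measurable ((f : X → ℂ) + (g : X → ℂ)) := Measurable.add hf hg
    exact h
  algebraMap_mem' r := (measurable_const : Measurable fun _ : X => r)
  star_mem' {f} hf := by
    have h : Measurable (fun x => star ((f : X → ℂ) x)) :=
      Complex.continuous_conj.measurable.comp hf
    exact h

instance isClosed_measurableSubalgebra :
    IsClosed (measurableSubalgebra X : Set (lp (fun _ : X => ℂ) ∞)) := by
  refine isClosed_of_closure_subset fun f hf => ?_
  obtain ⟨u, hu, hlim⟩ := mem_closure_iff_seq_limit.mp hf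
  refine measurable_of_tendsto_metrizable (f := fun n => (u n : X → ℂ)) hu ?_
  rw [tendsto_pi_nhds]
  intro x
  rw [tendsto_iff_norm_sub_tendsto_zero] at hlim ⊢
  refine squeeze_zero (fun _ => norm_nonneg _) (fun n => ?_) hlim
  exact lp.norm_apply_le_norm ENNReal.top_ne_zero (u n - f) x

/-- The C*-algebra `L^∞(X)` of bounded measurable functions `X → ℂ` (honest functions, not
classes modulo null sets). -/
abbrev Linf : Type _ := measurableSubalgebra X

namespace Linf

instance : CommCStarAlgebra (Linf X) :=
  StarSubalgebra.commCStarAlgebra (measurableSubalgebra X)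

variable {X}

instance : FunLike (Linf X) X ℂ where
  coe f := (f.1 : X → ℂ)
  coe_injective _ _ h := Subtype.ext (Subtype.ext h)

@[ext] theorem ext {f g : Linf X} (h : ∀ x, f x = g x) : f = g := DFunLike.ext f g h

theorem measurable (f : Linf X) : Measurable f := f.2

theorem norm_apply_le (f : Linf X) (x : X) : ‖f x‖ ≤ ‖f‖ :=
  lp.norm_apply_le_norm ENNReal.top_ne_zero f.1 x

/-- A bounded measurable function as an element of `L^∞(X)`. -/
def mk (f : X → ℂ) (hf : Measurable f) (C : ℝ) (hC : ∀ x, ‖f x‖ ≤ C) : Linf X :=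
  ⟨⟨f, memℓp_infty ⟨C, by rintro _ ⟨x, rfl⟩; exact hC x⟩⟩, hf⟩

@[simp] theorem mk_apply (f : X → ℂ) (hf : Measurable f) (C : ℝ) (hC : ∀ x, ‖f x‖ ≤ C) (x : X) :
    mk f hf C hC x = f x := rfl

@[simp] theorem add_apply (f g : Linf X) (x : X) : (f + g) x = f x + g x := rfl
@[simp] theorem sub_apply (f g : Linf X) (x : X) : (f - g) x = f x - g x := rfl
@[simp] theorem mul_apply (f g : Linf X) (x : X) : (f * g) x = f x * g x := rfl
@[simp] theorem star_apply (f : Linf X) (x : X) : (star f) x = star (f x) := rfl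
@[simp] theorem zero_apply (x : X) : (0 : Linf X) x = 0 := rfl
@[simp] theorem one_apply (x : X) : (1 : Linf X) x = 1 := rfl
@[simp] theorem smul_apply (c : ℂ) (f : Linf X) (x : X) : (c • f) x = c * f x := rfl

theorem norm_le {f : Linf X} {C : ℝ} (hC : 0 ≤ C) (h : ∀ x, ‖f x‖ ≤ C) : ‖f‖ ≤ C :=
  lp.norm_le_of_forall_le hC h

/-- The pointwise order. -/
instance : PartialOrder (Linf X) := PartialOrder.lift (fun f : Linf X => (f : X → ℂ))
  DFunLike.coe_injective

theorem le_def {f g : Linf X} : f ≤ g ↔ ∀ x, f x ≤ g x := Iff.rfl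

instance : StarOrderedRing (Linf X) := by
  refine StarOrderedRing.of_le_iff fun f g => ⟨fun h => ?_, ?_⟩
  · have hC : ∀ x, ‖((Real.sqrt ((g x - f x).re) : ℝ) : ℂ)‖ ≤ Real.sqrt ‖g - f‖ := fun x => by
      rw [Complex.norm_real, Real.norm_of_nonneg (Real.sqrt_nonneg _)]
      exact Real.sqrt_le_sqrt ((Complex.re_le_norm _).trans (norm_apply_le (g - f) x))
    refine ⟨mk (fun x => ((Real.sqrt ((g x - f x).re) : ℝ) : ℂ)) ?_ _ hC, ?_⟩
    · have := g.measurable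
      have := f.measurable
      fun_prop
    · ext x
      have hx := Complex.le_def.mp (h x)
      have h0 : 0 ≤ (g x - f x).re := by simpa using hx.1
      apply Complex.ext
      · simp [Real.mul_self_sqrt h0, -Complex.sub_re]
        simp
      · simp [hx.2]
  · rintro ⟨s, rfl⟩ x
    simpa using star_mul_self_nonneg (s x)

theorem isSelfAdjoint_iff {f : Linf X} : IsSelfAdjoint f ↔ ∀ x, IsSelfAdjoint (f x) :=
  DFunLike.ext_iff

theorem isSASup_of_pointwise {a : ℕ → Linf X} {s : Linf X}
    (h : ∀ x, IsSASup (fun n => a n x) (s x)) : IsSASup a s :=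
  ⟨⟨isSelfAdjoint_iff.2 fun x => (h x).1.1, fun n x => (h x).1.2 n⟩, fun _ ht x =>
    (h x).2 ⟨isSelfAdjoint_iff.1 ht.1 x, fun n => ht.2 n x⟩⟩

theorem exists_pointwise_sup {a : ℕ → Linf X} (ha : IsBddIncreasing a) :
    ∃ s : Linf X, ∀ x, IsSASup (fun n => a n x) (s x) := by
  obtain ⟨C, hC⟩ := ha.bounded
  have hre : ∀ n x, |(a n x).re| ≤ C := fun n x =>
    (Complex.abs_re_le_norm _).trans ((norm_apply_le _ _).trans (hC n))
  have him : ∀ n x, (a n x).im = 0 := fun n x =>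
    Complex.conj_eq_iff_im.1 (isSelfAdjoint_iff.1 (ha.selfAdjoint n) x)
  have hb : ∀ x, BddAbove (Set.range fun n => (a n x).re) := fun x =>
    ⟨C, by rintro _ ⟨n, rfl⟩; exact (abs_le.1 (hre n x)).2⟩
  have hmeas : Measurable fun x => ((⨆ n, (a n x).re : ℝ) : ℂ) := by
    refine Complex.measurable_ofReal.comp (Measurable.iSup fun n => ?_)
    exact Complex.measurable_re.comp (a n).measurable
  refine ⟨mk _ hmeas C fun x => ?_, fun x => ⟨⟨?_, fun n => ?_⟩, fun _ ht => ?_⟩⟩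
  · rw [Complex.norm_real, Real.norm_eq_abs, abs_le]
    exact ⟨(abs_le.1 (hre 0 x)).1.trans (le_ciSup (hb x) 0), ciSup_le fun n => (abs_le.1 (hre n x)).2⟩
  · exact Complex.conj_ofReal _
  · rw [mk_apply, Complex.le_def]
    exact ⟨by simpa using le_ciSup (hb x) n, by simp [him]⟩
  · rw [mk_apply, Complex.le_def]
    refine ⟨?_, ?_⟩
    · rw [Complex.ofReal_re]
      exact ciSup_le fun n => (Complex.le_def.1 (ht.2 n)).1
    · rw [Complex.ofReal_im]
      exact (Complex.conj_eq_iff_im.1 ht.1).symm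

/-- Suprema of bounded increasing sequences in `L^∞(X)` are pointwise. -/
theorem isSASup_iff_pointwise {a : ℕ → Linf X} (ha : IsBddIncreasing a) {s : Linf X} :
    IsSASup a s ↔ ∀ x, IsSASup (fun n => a n x) (s x) := by
  refine ⟨fun h => ?_, isSASup_of_pointwise⟩
  obtain ⟨t, ht⟩ := exists_pointwise_sup ha
  rwa [h.unique (isSASup_of_pointwise ht)]

theorem isSigmaCStar : IsSigmaCStar (Linf X) := fun _ ha =>
  (exists_pointwise_sup ha).imp fun _ => isSASup_of_pointwise

/-- Precomposition with a measurable map, as a `σ`-homomorphism `L^∞(Y) → L^∞(X)`. -/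
def pullback {Y : Type*} [MeasurableSpace Y] (f : X → Y) (hf : Measurable f) :
    SigmaHom (Linf Y) (Linf X) where
  toHom :=
    { toFun := fun g => mk (fun x => g (f x)) (g.measurable.comp hf) ‖g‖
        fun x => g.norm_apply_le (f x)
      map_one' := rfl
      map_mul' := fun _ _ => rfl
      map_zero' := rfl
      map_add' := fun _ _ => rfl
      commutes' := fun _ => rfl
      map_star' := fun _ => rfl }
  sigmaNormal := fun _ _ ha hs => isSASup_of_pointwise fun x =>
    (isSASup_iff_pointwise ha).1 hs (f x)

end Linf

end Linf

/-- The contravariant functor `L^∞` sending a measurable space to its algebra of bounded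
measurable functions, and a measurable map to precomposition with it. -/
def LinfFunctor : MeasCat.{u}ᵒᵖ ⥤ CSigmaCStar.{u} where
  obj X := { carrier := Linf X.unop, isSigma := Linf.isSigmaCStar }
  map f := Linf.pullback f.unop.1 f.unop.2
  map_id _ := rfl
  map_comp _ _ := rfl

/-! ### The Gelfand `σ`-spectrum -/

section Spectrum

variable (A : Type*) [CStarAlgebra A] [PartialOrder A] [StarOrderedRing A]

/-- The Gelfand `σ`-spectrum: the set of `σ`-homomorphisms `A → ℂ`. -/
def SigmaSpec : Type _ := SigmaHom A ℂ

/-- The smallest `σ`-algebra making all evaluations `φ ↦ φ a` measurable. -/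
instance : MeasurableSpace (SigmaSpec A) :=
  ⨆ a : A, MeasurableSpace.comap (fun φ : SigmaSpec A => φ.toHom a) (borel ℂ)

variable {A}

theorem measurable_eval (a : A) : Measurable fun φ : SigmaSpec A => φ.toHom a := by
  rw [Complex.borelSpace.measurable_eq]
  exact Measurable.of_comap_le
    (le_iSup (fun a : A => MeasurableSpace.comap (fun φ : SigmaSpec A => φ.toHom a) (borel ℂ)) a)

theorem measurable_to_sigmaSpec {X : Type*} [MeasurableSpace X] {f : X → SigmaSpec A}
    (h : ∀ a : A, Measurable fun x => (f x).toHom a) : Measurable f := by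
  refine Measurable.of_le_map (iSup_le fun a => ?_)
  rw [MeasurableSpace.comap_le_iff_le_map, MeasurableSpace.map_comp,
    ← Complex.borelSpace.measurable_eq]
  exact fun s hs => h a hs

end Spectrum

/-- The contravariant functor sending a commutative `σC*`-algebra to its Gelfand `σ`-spectrum,
and acting on morphisms by precomposition. -/
def SigmaSpecFunctor : CSigmaCStar.{u}ᵒᵖ ⥤ MeasCat.{u} where
  obj A := MeasCat.of (SigmaSpec A.unop.carrier)
  map f := ⟨fun φ => SigmaHom.comp φ f.unop,
    measurable_to_sigmaSpec fun a => measurable_eval (f.unop.toHom a)⟩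
  map_id _ := rfl
  map_comp _ _ := rfl

/-! ### Sober measurable spaces -/

/-- Pushforward of probability measures along a measurable map. -/
def giryMap {X Y : Type*} [MeasurableSpace X] [MeasurableSpace Y] (f : X → Y) (hf : Measurable f)
    (p : ProbabilityMeasure X) : ProbabilityMeasure Y :=
  ⟨(p : Measure X).map f, Measure.isProbabilityMeasure_map hf.aemeasurable⟩

theorem measurable_giryMap {X Y : Type*} [MeasurableSpace X] [MeasurableSpace Y] (f : X → Y)
    (hf : Measurable f) : Measurable (giryMap f hf) :=
  Measurable.subtype_mk ((Measure.measurable_map f hf).comp measurable_subtype_coe)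

/-- The underlying functor `P` of the Giry monad: `P X` is the set of probability measures on `X`
with the smallest `σ`-algebra making all evaluations `p ↦ p B`, for `B` measurable, measurable;
on morphisms, `P` is given by pushforward. -/
def giryP : MeasCat.{u} ⥤ MeasCat.{u} where
  obj X := MeasCat.of (ProbabilityMeasure X)
  map f := ⟨giryMap f.1 f.2, measurable_giryMap f.1 f.2⟩
  map_id _ := Subtype.ext <| funext fun _ => Subtype.ext Measure.map_id
  map_comp f g := Subtype.ext <| funext fun _ => Subtype.ext (Measure.map_map g.2 f.2).symm

/-- The unit of the Giry monad, sending a point `x` to the delta measure at `x`. -/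
def giryDelta : 𝟭 MeasCat.{u} ⟶ giryP where
  app _ := ⟨fun x => ⟨Measure.dirac x, Measure.dirac.isProbabilityMeasure⟩,
    Measure.measurable_dirac.subtype_mk⟩
  naturality _ _ f := Subtype.ext <| funext fun x => Subtype.ext (Measure.map_dirac' f.2 x).symm

/-- `X` is sober if `δ : X ⟶ P X` is an equalizer of `δ, P δ : P X ⟶ P (P X)` in the category of
measurable spaces. -/
def IsSober : ObjectProperty MeasCat.{u} := fun X =>
  Nonempty (Limits.IsLimit (Limits.Fork.ofι (f := giryDelta.app (giryP.obj X))
    (g := giryP.map (giryDelta.app X)) (giryDelta.app X) (giryDelta.naturality (giryDelta.app X))))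

/-- Commutative `σC*`-algebras which are purely `σ`-representable. -/
def IsPureRep : ObjectProperty CSigmaCStar.{u} := fun A =>
  IsPurelySigmaRepresentable A.carrier

/-- The full subcategory of sober measurable spaces. -/
abbrev SobMeas := IsSober.{u}.FullSubcategory

/-- The full subcategory of purely `σ`-representable commutative `σC*`-algebras. -/
abbrev CPureRep := IsPureRep.{u}.FullSubcategory

/-- An adjunction is idempotent if its induced monad is, i.e. the multiplication of the monad
is an isomorphism. -/
def IsIdempotentAdjunction {C D : Type*} [Category C] [Category D] {F : C ⥤ D} {G : D ⥤ C}
    (adj : F ⊣ G) : Prop :=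
  IsIso adj.toMonad.μ

/-- Restriction of `L^∞` to a contravariant functor from sober measurable spaces to purely
`σ`-representable commutative `σC*`-algebras, available if it preserves these properties. -/
def LinfRestrict (h : ∀ X : MeasCat.{u}, IsSober X → IsPureRep (LinfFunctor.obj (.op X))) :
    SobMeas.{u}ᵒᵖ ⥤ CPureRep.{u} :=
  IsPureRep.lift (IsSober.ι.op ⋙ LinfFunctor) fun X => h X.unop.obj X.unop.property

/-- Restriction of the Gelfand `σ`-spectrum to a contravariant functor from purely
`σ`-representable commutative `σC*`-algebras to sober measurable spaces, available if it
preserves these properties. -/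
def SigmaSpecRestrict
    (h : ∀ A : CSigmaCStar.{u}, IsPureRep A → IsSober (SigmaSpecFunctor.obj (.op A))) :
    CPureRep.{u}ᵒᵖ ⥤ SobMeas.{u} :=
  IsSober.lift (IsPureRep.ι.op ⋙ SigmaSpecFunctor) fun A => h A.unop.obj A.unop.property

end

end MeasGelfand

/-!
Both unit and counit are evaluation: the unit sends a point `x` of `X` to `f ↦ f x` on `L^∞(X)`, and
the counit is the Gelfand transform `A → L^∞(Spec A)`, so the triangle identities hold by
definition. The content lies in when these maps are invertible, and this is governed by zero-one
measures.

A `σ`-homomorphism `Φ : L^∞(X) → ℂ` takes idempotents to `0` or `1`, so `S ↦ Φ(1_S)` is a zero-one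
measure, and every bounded measurable `f` equals `Φ(f)` almost surely for it (`ae_eq_apply`).
Conversely, along a zero-one measure on `Spec A` every evaluation `φ ↦ φ(a)` is almost surely
constant, and the constants form a `σ`-homomorphism `φ` (`exists_ae_eq_of_zeroOne`). Because the
evaluations generate the `σ`-algebra of `Spec A`, the measure is the delta measure at `φ`. It
follows that every `σ`-homomorphism on `L^∞(Spec A)` is evaluation at a point
(`eval_comp_gelfand`), which is idempotency. Moreover, the probability measures equalized by
`δ_{PX}` and `P δ_X` are exactly the zero-one measures. Hence `Spec A` is sober
(`isSober_sigmaSpec`), and if `X` is sober, the equalizer property turns the measurable map from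
`Spec (L^∞ X)` to zero-one measures into an inverse of the unit (`exists_inverse_eval`).

For the counit, pure states of a commutative C*-algebra are multiplicative
(`map_mul_of_mem_extremePoints`) and characters are pure (`SigmaSpec.isPureSigmaState`). Hence pure
`σ`-states are the points of `Spec A`, and pure `σ`-representability says that the Gelfand transform
is injective. It is then an order embedding, so its range is closed under bounded monotone limits;
by the continuous functional calculus it contains the indicators of the generating sets, therefore
those of all measurable sets, and finally all bounded measurable functions (`gelfand_surjective`).
Pure `σ`-representability of `L^∞(X)` holds for every `X`, by evaluation at points.
-/

namespace MeasGelfand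

noncomputable section

/-! ### Filters concentrated at a point -/

/-- The `σ`-algebra of sets on which membership is `l`-almost surely decided by that of `y`. -/
abbrev concentratedAt {Y : Type*} (l : Filter Y) [CountableInterFilter l] (y : Y) :
    MeasurableSpace Y where
  MeasurableSet' S := ∀ᶠ x in l, x ∈ S ↔ y ∈ S
  measurableSet_empty := by simp
  measurableSet_compl S h := h.mono fun x hx => not_congr hx
  measurableSet_iUnion S h := by
    filter_upwards [eventually_countable_forall.2 h] with x hx
    simp only [Set.mem_iUnion, hx]

section Spectrum

variable {A : Type*} [CStarAlgebra A] [PartialOrder A] [StarOrderedRing A]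

theorem SigmaSpec.ext {φ ψ : SigmaSpec A} (h : ∀ a, φ.toHom a = ψ.toHom a) : φ = ψ :=
  SigmaHom.ext (StarAlgHom.ext h)

/-- A filter along which every evaluation is almost surely its value at `φ` is concentrated at
`φ`, because the evaluations generate the `σ`-algebra. -/
theorem SigmaSpec.eventually_mem_iff {l : Filter (SigmaSpec A)} [CountableInterFilter l]
    {φ : SigmaSpec A} (h : ∀ a, ∀ᶠ ψ : SigmaSpec A in l, ψ.toHom a = φ.toHom a)
    {S : Set (SigmaSpec A)} (hS : MeasurableSet S) : ∀ᶠ ψ in l, ψ ∈ S ↔ φ ∈ S := by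
  have hle : (inferInstance : MeasurableSpace (SigmaSpec A)) ≤ concentratedAt l φ := by
    refine iSup_le fun a => ?_
    rintro _ ⟨U, -, rfl⟩
    exact (h a).mono fun ψ hψ => by simp [hψ]
  exact hle S hS

end Spectrum

/-! ### Zero-one measures -/

section ZeroOne

theorem ae_eq_const_of_zeroOne {Y : Type*} [MeasurableSpace Y] {p : Measure Y}
    [IsProbabilityMeasure p] [IsZeroOneMeasure p] {f : Y → ℂ}
    (hf : Measurable f) : ∃ c, ∀ᵐ y ∂p, f y = c := by
  refine Filter.exists_eventuallyEq_const_of_forall_separating (l := ae p) MeasurableSet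
    fun U hU => ?_
  rcases p.zero_one (f ⁻¹' U) with h | h
  · exact .inr (measure_eq_zero_iff_ae_notMem.1 h)
  · exact .inl ((prob_compl_eq_zero_iff (hf hU)).2 h)

variable {A : Type*} [CStarAlgebra A] [PartialOrder A] [StarOrderedRing A]

/-- A zero-one measure on the `σ`-spectrum is concentrated at a point: every evaluation is almost
surely constant, and the resulting constants form a `σ`-homomorphism because the defining
identities involve only countably many elements at a time. -/
theorem SigmaSpec.exists_ae_eq_of_zeroOne {p : Measure (SigmaSpec A)} [IsProbabilityMeasure p]
    [IsZeroOneMeasure p] :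
    ∃ φ : SigmaSpec A, ∀ a, ∀ᵐ ψ : SigmaSpec A ∂p, ψ.toHom a = φ.toHom a := by
  choose c hc using fun a : A => ae_eq_const_of_zeroOne (p := p) (measurable_eval a)
  let φ : A →⋆ₐ[ℂ] ℂ :=
    { toFun := c
      map_one' := ?_
      map_mul' := ?_
      map_zero' := ?_
      map_add' := ?_
      commutes' := ?_
      map_star' := ?_ }
  · refine ⟨⟨φ, fun a s ha hs => ?_⟩, hc⟩
    obtain ⟨ψ, hψs, hψ⟩ := ((hc s).and (ae_all_iff.2 fun n => hc (a n))).exists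
    have := ψ.sigmaNormal a s ha hs
    simp only [hψ, hψs] at this
    exact this
  · obtain ⟨ψ, h⟩ := (hc 1).exists
    rw [← h, map_one]
  · intro a b
    obtain ⟨ψ, h, ha, hb⟩ := ((hc (a * b)).and ((hc a).and (hc b))).exists
    rw [← h, ← ha, ← hb, map_mul]
  · obtain ⟨ψ, h⟩ := (hc 0).exists
    exact h.symm.trans (map_zero ψ.toHom)
  · intro a b
    obtain ⟨ψ, h, ha, hb⟩ := ((hc (a + b)).and ((hc a).and (hc b))).exists
    exact h.symm.trans ((map_add ψ.toHom a b).trans (congrArg₂ _ ha hb))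
  · intro r
    obtain ⟨ψ, h⟩ := (hc (algebraMap ℂ A r)).exists
    exact h.symm.trans (AlgHomClass.commutes ψ.toHom r)
  · intro a
    obtain ⟨ψ, h, ha⟩ := ((hc (star a)).and (hc a)).exists
    exact h.symm.trans ((map_star ψ.toHom a).trans (congrArg _ ha))

theorem eq_dirac_of_ae_mem_iff {Y : Type*} [MeasurableSpace Y] {p : Measure Y}
    [IsProbabilityMeasure p] {y : Y} (h : ∀ S, MeasurableSet S → ∀ᵐ x ∂p, x ∈ S ↔ y ∈ S) :
    p = Measure.dirac y := by
  ext S hS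
  rw [Measure.dirac_apply' y hS]
  by_cases hy : y ∈ S
  · rw [Set.indicator_of_mem hy, Pi.one_apply, ← prob_compl_eq_zero_iff hS]
    exact (h S hS).mono fun x hx => hx.2 hy
  · rw [Set.indicator_of_notMem hy, measure_eq_zero_iff_ae_notMem]
    exact (h S hS).mono fun x hx hxS => hy (hx.1 hxS)

theorem SigmaSpec.exists_eq_dirac_of_zeroOne {p : Measure (SigmaSpec A)} [IsProbabilityMeasure p]
    [IsZeroOneMeasure p] :
    ∃ φ : SigmaSpec A, p = Measure.dirac φ := by
  obtain ⟨φ, h⟩ := SigmaSpec.exists_ae_eq_of_zeroOne (p := p)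
  exact ⟨φ, eq_dirac_of_ae_mem_iff fun S hS => SigmaSpec.eventually_mem_iff h hS⟩

theorem SigmaSpec.dirac_injective :
    Function.Injective (Measure.dirac : SigmaSpec A → Measure (SigmaSpec A)) := by
  intro φ ψ h
  refine SigmaSpec.ext fun a => ?_
  have hS : MeasurableSet {χ : SigmaSpec A | χ.toHom a = φ.toHom a} :=
    measurable_eval a (measurableSet_singleton _)
  have h1 := congrArg (fun q => q {χ : SigmaSpec A | χ.toHom a = φ.toHom a}) h
  simp only [Measure.dirac_apply' _ hS] at h1
  by_contra hne
  simp [Ne.symm hne] at h1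

/-- The measures equalized by the two maps `P Y ⟶ P (P Y)` are zero-one measures. -/
theorem isZeroOneMeasure_of_dirac_eq_map {Y : Type*} [MeasurableSpace Y] {p : ProbabilityMeasure Y}
    (h : Measure.dirac p = (p : Measure Y).map diracProba) : IsZeroOneMeasure (p : Measure Y) := by
  refine ⟨fun S hS => ?_⟩
  have hT : MeasurableSet {q : ProbabilityMeasure Y | (q : Measure Y) S = (p : Measure Y) S} :=
    ((Measure.measurable_coe hS).comp measurable_subtype_coe) (measurableSet_singleton _)
  have h1 := congrArg (fun P : Measure (ProbabilityMeasure Y) =>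
    P {q : ProbabilityMeasure Y | (q : Measure Y) S = (p : Measure Y) S}) h
  have hd : Measurable (diracProba : Y → ProbabilityMeasure Y) :=
    Measure.measurable_dirac.subtype_mk
  simp only [Measure.dirac_apply' _ hT, Measure.map_apply hd hT] at h1
  by_contra! hne
  have he :
      diracProba ⁻¹' {q : ProbabilityMeasure Y | (q : Measure Y) S = (p : Measure Y) S} = ∅ := by
    refine Set.eq_empty_of_forall_notMem fun y hy => ?_
    change Measure.dirac y S = _ at hy
    rw [Measure.dirac_apply' _ hS] at hy
    by_cases hyS : y ∈ S
    · exact hne.2 (by rw [← hy]; simp [hyS])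
    · exact hne.1 (by rw [← hy]; simp [hyS])
  rw [he] at h1
  simp at h1

end ZeroOne

/-- Every Gelfand `σ`-spectrum is sober, since its zero-one measures are delta measures. -/
theorem isSober_sigmaSpec (A : CSigmaCStar.{u}) : IsSober (SigmaSpecFunctor.obj (.op A)) := by
  have key (s : Limits.Fork (giryDelta.app (giryP.obj (SigmaSpecFunctor.obj (.op A))))
      (giryP.map (giryDelta.app (SigmaSpecFunctor.obj (.op A))))) :
      ∃ φ : s.pt → SigmaSpec A.carrier, Measurable φ ∧ diracProba ∘ φ = s.ι.1 := by
    obtain ⟨k, hk, hks⟩ : ∃ k : s.pt → ProbabilityMeasure (SigmaSpec A.carrier),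
        Measurable k ∧ s.ι.1 = k := ⟨s.ι.1, s.ι.2, rfl⟩
    have hkz (z) : Measure.dirac (k z) = (k z : Measure (SigmaSpec A.carrier)).map diracProba := by
      rw [← hks]
      exact congrArg Subtype.val (congrFun (congrArg Subtype.val s.condition) z)
    have hex (z) : ∃ φ : SigmaSpec A.carrier, (k z : Measure (SigmaSpec A.carrier)) = .dirac φ :=
      have := isZeroOneMeasure_of_dirac_eq_map (hkz z)
      SigmaSpec.exists_eq_dirac_of_zeroOne
    choose φ hφ using hex
    refine ⟨φ, fun S hS => ?_, hks ▸ funext fun z => Subtype.ext (hφ z).symm⟩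
    have hm : Measurable fun z => (k z : Measure (SigmaSpec A.carrier)) S :=
      (Measure.measurable_coe hS).comp (measurable_subtype_coe.comp hk)
    convert hm (measurableSet_singleton 1) using 1
    ext z
    by_cases hz : φ z ∈ S <;> simp [hφ, Measure.dirac_apply' _ hS, hz]
  choose φ hφm hφ using key
  refine ⟨Limits.Fork.IsLimit.mk _ (fun s => ⟨φ s, hφm s⟩) (fun s => ?_) fun s m hm => ?_⟩
  · exact Subtype.ext (hφ s)
  · refine Subtype.ext (funext fun z => SigmaSpec.dirac_injective ?_)
    exact congrArg Subtype.val
      ((congrFun (congrArg Subtype.val hm) z).trans (congrFun (hφ s) z).symm)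

/-! ### `σ`-homomorphisms on algebras of bounded measurable functions -/

namespace Linf

variable {X : Type*} [MeasurableSpace X]

/-- The indicator function of a measurable set, as an element of `L^∞(X)`. -/
def indicator (S : Set X) (hS : MeasurableSet S) : Linf X :=
  mk (S.indicator 1) (measurable_one.indicator hS) 1 fun x =>
    (norm_indicator_le_norm_self 1 x).trans (by simp)

theorem indicator_apply (S : Set X) (hS : MeasurableSet S) (x : X) :
    indicator S hS x = S.indicator 1 x := rfl

theorem indicator_of_mem {S : Set X} (hS : MeasurableSet S) {x : X} (hx : x ∈ S) :
    indicator S hS x = 1 := Set.indicator_of_mem hx 1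

theorem indicator_of_notMem {S : Set X} (hS : MeasurableSet S) {x : X} (hx : x ∉ S) :
    indicator S hS x = 0 := Set.indicator_of_notMem hx 1

theorem indicator_nonneg (S : Set X) (hS : MeasurableSet S) : 0 ≤ indicator S hS :=
  le_def.2 fun x => by
  by_cases hx : x ∈ S
  · simp [indicator_of_mem hS hx]
  · simp [indicator_of_notMem hS hx]

theorem indicator_mono {S T : Set X} (hS : MeasurableSet S) (hT : MeasurableSet T) (h : S ⊆ T) :
    indicator S hS ≤ indicator T hT := le_def.2 fun x => by
  by_cases hx : x ∈ S
  · rw [indicator_of_mem hS hx, indicator_of_mem hT (h hx)]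
  · rw [indicator_of_notMem hS hx]
    exact le_def.1 (indicator_nonneg T hT) x

theorem indicator_univ : indicator (Set.univ : Set X) .univ = 1 :=
  ext fun x => indicator_of_mem .univ (Set.mem_univ x)

theorem indicator_mul_indicator {S T : Set X} (hS : MeasurableSet S) (hT : MeasurableSet T) :
    indicator S hS * indicator T hT = indicator (S ∩ T) (hS.inter hT) := by
  ext x
  rw [mul_apply, indicator_apply, indicator_apply, indicator_apply, Set.inter_indicator_one]
  rfl

theorem norm_indicator_le (S : Set X) (hS : MeasurableSet S) : ‖indicator S hS‖ ≤ 1 :=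
  norm_le zero_le_one fun x => (norm_indicator_le_norm_self 1 x).trans (by simp)

theorem isBddIncreasing_indicator {S : ℕ → Set X} (hS : ∀ n, MeasurableSet (S n))
    (hmono : Monotone S) : IsBddIncreasing fun n => indicator (S n) (hS n) where
  selfAdjoint n := IsSelfAdjoint.of_nonneg (indicator_nonneg (S n) (hS n))
  le_succ n := indicator_mono (hS n) (hS (n + 1)) (hmono n.le_succ)
  bounded := ⟨1, fun n => norm_indicator_le (S n) (hS n)⟩

theorem isSASup_indicator_iUnion {S : ℕ → Set X} (hS : ∀ n, MeasurableSet (S n)) :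
    IsSASup (fun n => indicator (S n) (hS n)) (indicator (⋃ n, S n) (.iUnion hS)) := by
  refine ⟨⟨IsSelfAdjoint.of_nonneg (indicator_nonneg _ _),
    fun n => indicator_mono _ _ (Set.subset_iUnion S n)⟩, fun t ht => le_def.2 fun x => ?_⟩
  by_cases hx : x ∈ ⋃ n, S n
  · obtain ⟨n, hn⟩ := Set.mem_iUnion.1 hx
    rw [indicator_of_mem _ hx, ← indicator_of_mem (hS n) hn]
    exact le_def.1 (ht.2 n) x
  · rw [indicator_of_notMem _ hx]
    exact (le_def.1 (indicator_nonneg _ (hS 0)) x).trans (le_def.1 (ht.2 0) x)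

/-- Evaluation at a point, as a `σ`-homomorphism. -/
def eval (x : X) : SigmaSpec (Linf X) where
  toHom :=
    { toFun := fun f => f x
      map_one' := rfl
      map_mul' := fun _ _ => rfl
      map_zero' := rfl
      map_add' := fun _ _ => rfl
      commutes' := fun _ => rfl
      map_star' := fun _ => rfl }
  sigmaNormal := fun _ _ ha hs => (isSASup_iff_pointwise ha).1 hs x

@[simp] theorem eval_toHom_apply (x : X) (f : Linf X) : (eval x).toHom f = f x := rfl

theorem measurable_eval : Measurable (eval : X → SigmaSpec (Linf X)) :=
  measurable_to_sigmaSpec fun f => f.measurable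

end Linf

section HomMeasure

variable {X : Type*} [MeasurableSpace X] (Φ : SigmaSpec (Linf X))

namespace SigmaSpec

theorem apply_indicator_eq_zero_or_one {S : Set X} (hS : MeasurableSet S) :
    Φ.toHom (Linf.indicator S hS) = 0 ∨ Φ.toHom (Linf.indicator S hS) = 1 := by
  have h : Φ.toHom (Linf.indicator S hS) * Φ.toHom (Linf.indicator S hS) =
      Φ.toHom (Linf.indicator S hS) := by
    rw [← map_mul, Linf.indicator_mul_indicator]
    simp only [Set.inter_self]
  exact IsIdempotentElem.iff_eq_zero_or_one.1 h

theorem apply_indicator_mono {S T : Set X} (hS : MeasurableSet S) (hT : MeasurableSet T)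
    (h : S ⊆ T) (hΦ : Φ.toHom (Linf.indicator S hS) = 1) :
    Φ.toHom (Linf.indicator T hT) = 1 := by
  refine (Φ.apply_indicator_eq_zero_or_one hT).resolve_left fun h0 => ?_
  have := OrderHomClass.mono Φ.toHom (Linf.indicator_mono hS hT h)
  rw [hΦ, h0] at this
  exact absurd this (zero_lt_one.not_ge)

theorem apply_indicator_union {S T : Set X} (hS : MeasurableSet S) (hT : MeasurableSet T)
    (h : Φ.toHom (Linf.indicator (S ∪ T) (hS.union hT)) = 1) :
    Φ.toHom (Linf.indicator S hS) = 1 ∨ Φ.toHom (Linf.indicator T hT) = 1 := by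
  by_contra! hne
  have h0S := (Φ.apply_indicator_eq_zero_or_one hS).resolve_right hne.1
  have h0T := (Φ.apply_indicator_eq_zero_or_one hT).resolve_right hne.2
  have hle : Linf.indicator (S ∪ T) (hS.union hT) ≤ Linf.indicator S hS + Linf.indicator T hT := by
    refine Linf.le_def.2 fun x => ?_
    rw [Linf.add_apply]
    by_cases hx : x ∈ S
    · rw [Linf.indicator_of_mem (hS.union hT) (Or.inl hx), Linf.indicator_of_mem hS hx]
      exact le_add_of_nonneg_right (Linf.le_def.1 (Linf.indicator_nonneg T hT) x)
    by_cases hx' : x ∈ T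
    · rw [Linf.indicator_of_mem (hS.union hT) (Or.inr hx'), Linf.indicator_of_mem hT hx']
      exact le_add_of_nonneg_left (Linf.le_def.1 (Linf.indicator_nonneg S hS) x)
    · rw [Linf.indicator_of_notMem (hS.union hT) (not_or.2 ⟨hx, hx'⟩)]
      exact add_nonneg (Linf.le_def.1 (Linf.indicator_nonneg S hS) x)
        (Linf.le_def.1 (Linf.indicator_nonneg T hT) x)
  have := OrderHomClass.mono Φ.toHom hle
  rw [map_add, h, h0S, h0T, add_zero] at this
  exact absurd this (zero_lt_one.not_ge)

theorem exists_apply_indicator_eq_one {S : ℕ → Set X} (hS : ∀ n, MeasurableSet (S n))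
    (h : Φ.toHom (Linf.indicator (⋃ n, S n) (.iUnion hS)) = 1) :
    ∃ n, Φ.toHom (Linf.indicator (S n) (hS n)) = 1 := by
  by_contra! hne
  have hacc (n) : MeasurableSet (Set.accumulate S n) :=
    .biUnion (Set.to_countable _) fun i _ => hS i
  have h0 (n) : Φ.toHom (Linf.indicator (Set.accumulate S n) (hacc n)) ≠ 1 := by
    induction n with
    | zero => simpa using hne 0
    | succ n ih =>
      intro h1
      simp only [Set.accumulate_succ] at h1
      exact (Φ.apply_indicator_union (hacc n) (hS (n + 1)) h1).elim ih (hne _)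
  have h1 (n) := (Φ.apply_indicator_eq_zero_or_one (hacc n)).resolve_right (h0 n)
  have h2 := Φ.sigmaNormal _ _ (Linf.isBddIncreasing_indicator hacc Set.monotone_accumulate)
    (Linf.isSASup_indicator_iUnion hacc)
  simp only [h1, Set.iUnion_accumulate, h] at h2
  have h3 : (1 : ℂ) ≤ 0 := h2.2 ⟨.zero ℂ, fun _ => le_rfl⟩
  exact absurd h3 (zero_lt_one.not_ge)

open Classical in
/-- The zero-one measure `S ↦ Φ(1_S)` of a `σ`-homomorphism `Φ : L^∞(X) → ℂ`. -/
def measure : Measure X :=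
  Measure.ofMeasurable (fun S hS => if Φ.toHom (Linf.indicator S hS) = 1 then 1 else 0)
    (by
      have : Linf.indicator (∅ : Set X) .empty = 0 :=
        Linf.ext fun x => Linf.indicator_of_notMem .empty (Set.notMem_empty x)
      simp [this])
    (by
      intro S hS hd
      by_cases h : ∃ n, Φ.toHom (Linf.indicator (S n) (hS n)) = 1
      · obtain ⟨n, hn⟩ := h
        rw [if_pos (Φ.apply_indicator_mono _ _ (Set.subset_iUnion S n) hn), tsum_eq_single n,
          if_pos hn]
        intro m hm
        refine if_neg fun h1 => ?_
        have h2 : Linf.indicator (S m) (hS m) * Linf.indicator (S n) (hS n) = 0 := by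
          rw [Linf.indicator_mul_indicator]
          refine Linf.ext fun x => Linf.indicator_of_notMem _ ?_
          rw [(hd hm).inter_eq]
          exact Set.notMem_empty x
        have h3 := congrArg Φ.toHom h2
        rw [map_mul, h1, hn, map_zero] at h3
        simp at h3
      · rw [if_neg fun h1 => h (Φ.exists_apply_indicator_eq_one hS h1)]
        push Not at h
        simp [h])

open Classical in
theorem measure_apply {S : Set X} (hS : MeasurableSet S) :
    Φ.measure S = if Φ.toHom (Linf.indicator S hS) = 1 then 1 else 0 :=
  Measure.ofMeasurable_apply S hS

instance : IsProbabilityMeasure Φ.measure where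
  measure_univ := by rw [Φ.measure_apply .univ, Linf.indicator_univ, map_one, if_pos rfl]

instance : IsZeroOneMeasure Φ.measure where
  zero_one₀ S hS := by
    rw [Φ.measure_apply hS]
    split_ifs
    · exact .inr rfl
    · exact .inl rfl

theorem measurable_measure : Measurable (measure : SigmaSpec (Linf X) → Measure X) := by
  classical
  refine Measure.measurable_of_measurable_coe _ fun S hS => ?_
  simp only [measure_apply _ hS]
  exact Measurable.ite (MeasGelfand.measurable_eval _ (measurableSet_singleton 1))
    measurable_const measurable_const

/-- Since `Φ` annihilates `|f - Φ(f)|²`, it annihilates by monotonicity the indicators of the sets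
where this function is at least `1 / (n + 1)`. -/
theorem ae_eq_apply (f : Linf X) : ∀ᵐ x ∂Φ.measure, f x = Φ.toHom f := by
  classical
  let d : Linf X := f - algebraMap ℂ (Linf X) (Φ.toHom f)
  have hd : Φ.toHom d = 0 := by
    change Φ.toHom (f - _) = 0
    rw [map_sub, AlgHomClass.commutes]
    simp
  have hdx (x) : d x = f x - Φ.toHom f := by
    change f x - (algebraMap ℂ (Linf X) (Φ.toHom f)) x = _
    congr 1
  have hS (n : ℕ) : MeasurableSet {x | 1 ≤ (n + 1) * ‖d x‖ ^ 2} :=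
    measurableSet_le measurable_const ((d.measurable.norm.pow_const 2).const_mul _)
  have key (n : ℕ) : ∀ᵐ x ∂Φ.measure, ¬ 1 ≤ (n + 1) * ‖d x‖ ^ 2 := by
    suffices h0 : Φ.measure {x | 1 ≤ (n + 1) * ‖d x‖ ^ 2} = 0 from
      measure_eq_zero_iff_ae_notMem.1 h0
    rw [Φ.measure_apply (hS n), if_neg]
    intro h1
    have hle : Linf.indicator _ (hS n) ≤ ((n + 1 : ℝ) : ℂ) • (star d * d) := by
      refine Linf.le_def.2 fun x => ?_
      have hx : (((n + 1 : ℝ) : ℂ) • (star d * d)) x = (((n + 1) * ‖d x‖ ^ 2 : ℝ) : ℂ) := by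
        rw [Linf.smul_apply, Linf.mul_apply, Linf.star_apply]
        simp [Complex.conj_mul']
      rw [hx]
      by_cases hxS : 1 ≤ (n + 1) * ‖d x‖ ^ 2
      · rw [Linf.indicator_of_mem (hS n) hxS]
        exact_mod_cast hxS
      · rw [Linf.indicator_of_notMem (hS n) hxS]
        have : 0 ≤ (n + 1) * ‖d x‖ ^ 2 := by positivity
        exact_mod_cast this
    have := OrderHomClass.mono Φ.toHom hle
    rw [h1, map_smul, map_mul, hd, mul_zero, smul_zero] at this
    exact absurd this (zero_lt_one.not_ge)
  filter_upwards [ae_all_iff.2 key] with x hx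
  rw [← sub_eq_zero, ← hdx, ← norm_eq_zero]
  by_contra hne
  have hpos : 0 < ‖d x‖ ^ 2 := by positivity
  obtain ⟨n, hn⟩ := exists_nat_ge (1 / ‖d x‖ ^ 2)
  refine hx n ?_
  rw [div_le_iff₀ hpos] at hn
  nlinarith

end SigmaSpec

end HomMeasure

/-- The Gelfand transform `A → L^∞(Spec A)`, sending `a` to evaluation at `a`. -/
def gelfand (A : Type*) [CStarAlgebra A] [PartialOrder A] [StarOrderedRing A] :
    SigmaHom A (Linf (SigmaSpec A)) where
  toHom :=
    { toFun := fun a => Linf.mk (fun φ : SigmaSpec A => φ.toHom a) (measurable_eval a) ‖a‖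
        fun φ => NonUnitalStarAlgHom.norm_apply_le φ.toHom a
      map_one' := Linf.ext fun φ => map_one φ.toHom
      map_mul' := fun a b => Linf.ext fun φ => map_mul φ.toHom a b
      map_zero' := Linf.ext fun φ => map_zero φ.toHom
      map_add' := fun a b => Linf.ext fun φ => map_add φ.toHom a b
      commutes' := fun r => Linf.ext fun φ => AlgHomClass.commutes φ.toHom r
      map_star' := fun a => Linf.ext fun φ => map_star φ.toHom a }
  sigmaNormal := fun a s ha hs => Linf.isSASup_of_pointwise fun φ => φ.sigmaNormal a s ha hs

theorem gelfand_apply {A : Type*} [CStarAlgebra A] [PartialOrder A] [StarOrderedRing A] (a : A)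
    (φ : SigmaSpec A) : (gelfand A).toHom a φ = φ.toHom a := rfl

/-- Every `σ`-homomorphism on `L^∞(Spec A)` is evaluation at a point of `Spec A`: its zero-one
measure is concentrated at its composite with the Gelfand transform. -/
theorem eval_comp_gelfand {A : Type*} [CStarAlgebra A] [PartialOrder A] [StarOrderedRing A]
    (Φ : SigmaSpec (Linf (SigmaSpec A))) :
    Linf.eval (X := SigmaSpec A) (SigmaHom.comp Φ (gelfand A)) = Φ := by
  refine SigmaSpec.ext fun f => ?_
  set φ : SigmaSpec A := SigmaHom.comp Φ (gelfand A)
  have hφ (a : A) : ∀ᵐ ψ : SigmaSpec A ∂Φ.measure, ψ.toHom a = φ.toHom a :=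
    Φ.ae_eq_apply ((gelfand A).toHom a)
  have hS : MeasurableSet {ψ : SigmaSpec A | f ψ = f φ} := f.measurable (measurableSet_singleton _)
  obtain ⟨ψ, h1, h2⟩ := ((SigmaSpec.eventually_mem_iff hφ hS).and (Φ.ae_eq_apply f)).exists
  exact (h1.2 rfl).symm.trans h2

/-- Zero-one measures are equalized by the two maps `P Y ⟶ P (P Y)`. -/
theorem dirac_eq_map_of_isZeroOneMeasure {Y : Type*} [MeasurableSpace Y] (p : ProbabilityMeasure Y)
    [IsZeroOneMeasure (p : Measure Y)] :
    Measure.dirac p = (p : Measure Y).map diracProba := by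
  have hd : Measurable (diracProba : Y → ProbabilityMeasure Y) :=
    Measure.measurable_dirac.subtype_mk
  have := Measure.isProbabilityMeasure_map (μ := (p : Measure Y)) hd.aemeasurable
  refine (eq_dirac_of_ae_mem_iff fun T hT => ?_).symm
  have hle : (inferInstance : MeasurableSpace (ProbabilityMeasure Y)) ≤
      concentratedAt (ae ((p : Measure Y).map diracProba)) p := by
    refine (MeasurableSpace.comap_le_iff_le_map).2 (iSup₂_le fun S hS => ?_)
    rintro _ ⟨U, hU, rfl⟩
    have hU' : MeasurableSet {q : ProbabilityMeasure Y |
        (q : Measure Y) S ∈ U ↔ (p : Measure Y) S ∈ U} := by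
      have : MeasurableSet {q : ProbabilityMeasure Y | (q : Measure Y) S ∈ U} :=
        ((Measure.measurable_coe hS).comp measurable_subtype_coe) hU
      by_cases h : (p : Measure Y) S ∈ U
      · simpa [h] using this
      · simp only [h, iff_false]
        exact this.compl
    refine (ae_map_iff hd.aemeasurable hU').2 ?_
    have h01 : ∀ᵐ y ∂(p : Measure Y), Measure.dirac y S = (p : Measure Y) S := by
      rcases (p : Measure Y).zero_one S with h | h
      · filter_upwards [measure_eq_zero_iff_ae_notMem.1 h] with y hy
        simp [Measure.dirac_apply' _ hS, hy, h]
      · filter_upwards [(prob_compl_eq_zero_iff hS).2 h] with y hy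
        simp [Measure.dirac_apply' _ hS, show y ∈ S from hy, h]
    filter_upwards [h01] with y hy
    change Measure.dirac y S ∈ U ↔ _
    rw [hy]
  exact hle T hT

/-- On a sober space every `σ`-homomorphism `L^∞(X) → ℂ` is evaluation at a point depending
measurably on it. -/
theorem exists_inverse_eval {X : MeasCat.{u}} (hX : IsSober X) :
    ∃ g : SigmaSpec (Linf X) → X, Measurable g ∧ (∀ x, g (Linf.eval x) = x) ∧
      ∀ Φ, Linf.eval (g Φ) = Φ := by
  obtain ⟨hlim⟩ := hX
  let k : MeasCat.of (SigmaSpec (Linf X)) ⟶ giryP.obj X :=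
    ⟨fun Φ => (⟨Φ.measure, inferInstance⟩ : ProbabilityMeasure X),
      SigmaSpec.measurable_measure.subtype_mk⟩
  have hk : k ≫ giryDelta.app (giryP.obj X) = k ≫ giryP.map (giryDelta.app X) := by
    refine Subtype.ext (funext fun Φ => Subtype.ext ?_)
    exact @dirac_eq_map_of_isZeroOneMeasure X _ ⟨Φ.measure, inferInstance⟩
      (inferInstanceAs (IsZeroOneMeasure Φ.measure))
  obtain ⟨g, hg⟩ := Limits.Fork.IsLimit.lift' hlim k hk
  have hgΦ (Φ : SigmaSpec (Linf X)) : Measure.dirac (g.1 Φ) = Φ.measure :=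
    congrArg Subtype.val (congrFun (congrArg Subtype.val hg) Φ)
  have hright (Φ : SigmaSpec (Linf X)) : Linf.eval (g.1 Φ) = Φ := by
    refine SigmaSpec.ext fun f => ?_
    have h := Φ.ae_eq_apply f
    rw [← hgΦ Φ] at h
    exact (ae_dirac_iff (f.measurable (measurableSet_singleton _))).1 h
  refine ⟨g.1, g.2, ?_, hright⟩
  let e : X ⟶ MeasCat.of (SigmaSpec (Linf X)) := ⟨Linf.eval, Linf.measurable_eval⟩
  have he : e ≫ g = 𝟙 X := by
    refine Limits.Fork.IsLimit.hom_ext hlim ?_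
    refine Subtype.ext (funext fun x => Subtype.ext ?_)
    change Measure.dirac (g.1 (Linf.eval x)) = Measure.dirac x
    ext S hS
    classical
    rw [hgΦ, SigmaSpec.measure_apply _ hS, Measure.dirac_apply' _ hS, Linf.eval_toHom_apply]
    by_cases hx : x ∈ S
    · simp [Linf.indicator_of_mem hS hx, hx]
    · simp [Linf.indicator_of_notMem hS hx, hx]
  exact fun x => congrFun (congrArg Subtype.val he) x

/-! ### Pure states are characters -/

section States

variable {A : Type*} [CStarAlgebra A] [PartialOrder A] [StarOrderedRing A]

theorem isSelfAdjoint_map_of_mem_states {φ : A →ₗ[ℂ] ℂ} (hφ : φ ∈ states A) {a : A}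
    (ha : IsSelfAdjoint a) : IsSelfAdjoint (φ a) := by
  have h1 : 0 ≤ φ (algebraMap ℝ A ‖a‖ - a) :=
    hφ.1 _ (sub_nonneg.2 ha.le_algebraMap_norm_self)
  have h2 : 0 ≤ φ (algebraMap ℝ A ‖a‖) :=
    hφ.1 _ (algebraMap_nonneg A (norm_nonneg a))
  have h3 := (IsSelfAdjoint.of_nonneg h2).sub (IsSelfAdjoint.of_nonneg h1)
  rwa [map_sub, sub_sub_cancel] at h3

theorem map_star_of_mem_states {φ : A →ₗ[ℂ] ℂ} (hφ : φ ∈ states A) (a : A) :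
    φ (star a) = star (φ a) := by
  have hre := isSelfAdjoint_map_of_mem_states hφ (realPart a).2
  have him := isSelfAdjoint_map_of_mem_states hφ (imaginaryPart a).2
  have h := realPart_add_I_smul_imaginaryPart a
  have h' : star a = (realPart a : A) - Complex.I • (imaginaryPart a : A) := by
    conv_lhs => rw [← h]
    simp [(realPart a).2.star_eq, (imaginaryPart a).2.star_eq, sub_eq_add_neg]
  have h'' : φ a = φ (realPart a : A) + Complex.I * φ (imaginaryPart a : A) := by
    conv_lhs => rw [← h]
    simp
  rw [h', h'', map_sub, map_smul, star_add, star_mul', hre.star_eq, him.star_eq]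
  simp [sub_eq_add_neg]

/-- A state vanishes where the associated inner product does, by the Cauchy–Schwarz inequality
with the unit: positivity of `α` at `(d - α(d))^* (d - α(d))` reads `0 ≤ α(d^* d) - |α(d)|²`. -/
theorem map_eq_zero_of_mem_states {α : A →ₗ[ℂ] ℂ} (hα : α ∈ states A) {d : A}
    (h : α (star d * d) = 0) : α d = 0 := by
  have h1 := hα.1 _ (star_mul_self_nonneg (d - algebraMap ℂ A (α d)))
  have h2 : star (d - algebraMap ℂ A (α d)) * (d - algebraMap ℂ A (α d)) =
      star d * d - α d • star d - star (α d) • d + (star (α d) * α d) • 1 := by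
    simp only [Algebra.algebraMap_eq_smul_one, star_sub, star_smul, star_one, sub_mul, mul_sub,
      mul_smul_comm, smul_mul_assoc, mul_one, one_mul, smul_sub, smul_smul]
    rw [mul_comm (α d) (star (α d))]
    abel
  rw [h2, map_add, map_sub, map_sub, h, map_smul, map_smul, map_smul, hα.2,
    map_star_of_mem_states hα] at h1
  have h3 : (0 - α d • star (α d) - star (α d) • α d + (star (α d) * α d) • (1 : ℂ)) =
      ((-(‖α d‖ ^ 2) : ℝ) : ℂ) := by
    have := Complex.conj_mul' (α d)
    simp only [smul_eq_mul, mul_one]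
    push_cast
    rw [← this]
    change _ - _ * star _ - _ + _ = -(star _ * _)
    ring
  rw [h3] at h1
  have h4 : 0 ≤ -(‖α d‖ ^ 2) := by exact_mod_cast h1
  have h5 : ‖α d‖ ^ 2 = 0 := le_antisymm (by linarith) (by positivity)
  exact norm_eq_zero.1 (pow_eq_zero_iff two_ne_zero |>.1 h5)

/-- A character `φ` is extremal among the states: if it is a convex combination of states, these
annihilate `(a - φ(a))^* (a - φ(a))`, hence take the value `φ(a)` at `a`. -/
theorem SigmaSpec.isPureSigmaState (φ : SigmaSpec A) :
    IsPureSigmaState (φ.toHom : A →ₗ[ℂ] ℂ) := by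
  refine ⟨mem_extremePoints_iff_left.2 ⟨⟨fun x hx => ?_, map_one φ.toHom⟩, ?_⟩, φ.sigmaNormal⟩
  · exact map_nonneg φ.toHom hx
  rintro α hα β hβ ⟨s, t, hs, ht, -, hst⟩
  ext a
  set d : A := a - algebraMap ℂ A (φ.toHom a)
  have hd : φ.toHom d = 0 := by
    simp only [d, map_sub, AlgHomClass.commutes]
    simp
  have h0 := LinearMap.congr_fun hst (star d * d)
  have h0' : (φ.toHom : A →ₗ[ℂ] ℂ) (star d * d) = 0 := by
    change φ.toHom (star d * d) = 0
    rw [map_mul, hd, mul_zero]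
  rw [h0', LinearMap.add_apply, LinearMap.smul_apply, LinearMap.smul_apply] at h0
  have h1 := hα.1 _ (star_mul_self_nonneg d)
  have h2 := hβ.1 _ (star_mul_self_nonneg d)
  have h3 := (add_eq_zero_iff_of_nonneg (smul_nonneg hs.le h1) (smul_nonneg ht.le h2)).1 h0
  have h4 := map_eq_zero_of_mem_states hα ((smul_eq_zero.1 h3.1).resolve_left hs.ne')
  simp only [d, map_sub, Algebra.algebraMap_eq_smul_one, map_smul, hα.2, smul_eq_mul,
    mul_one] at h4
  exact sub_eq_zero.1 h4

end States

section PureStates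

variable {A : Type*} [CommCStarAlgebra A] [PartialOrder A] [StarOrderedRing A]

/-- An extremal state is multiplicative. When `1/4 ≤ a ≤ 3/4` it is the convex combination of the
states `x ↦ φ(ax)/φ(a)` and `x ↦ φ((1-a)x)/φ(1-a)`, so both agree with it; the general
case follows by linearity. -/
theorem map_mul_of_mem_extremePoints {φ : A →ₗ[ℂ] ℂ} (hφ : φ ∈ (states A).extremePoints ℝ)
    (a x : A) : φ (a * x) = φ a * φ x := by
  obtain ⟨hφs, hext⟩ := mem_extremePoints_iff_left.1 hφ
  -- the case in which `a` and `1 - a` are positive and `φ` vanishes on neither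
  have core (a : A) (ha : 0 ≤ a) (ha' : 0 ≤ 1 - a) (t : ℝ) (ht : φ a = t) (ht0 : 0 < t)
      (ht1 : t < 1) (x : A) : φ (a * x) = φ a * φ x := by
    have hst (b : A) (hb : 0 ≤ b) (s : ℝ) (hs : φ b = s) (hs0 : 0 < s) :
        ((s : ℂ)⁻¹ • φ ∘ₗ LinearMap.mulLeft ℂ b) ∈ states A := by
      refine ⟨fun y hy => ?_, ?_⟩
      · have h0 : 0 ≤ φ (b * y) := hφs.1 _ (Commute.mul_nonneg hb hy (Commute.all b y))
        have h1 : (0 : ℂ) ≤ (s : ℂ)⁻¹ := by exact_mod_cast inv_nonneg.2 hs0.le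
        simpa using mul_nonneg h1 h0
      · have : (s : ℂ) ≠ 0 := by exact_mod_cast hs0.ne'
        simp [hs, this]
    have h1 := hst a ha t ht ht0
    have h2 := hst (1 - a) ha' (1 - t) (by simp [ht, hφs.2]) (by linarith)
    have hne : (t : ℂ) ≠ 0 := by exact_mod_cast ht0.ne'
    have hne' : ((1 - t : ℝ) : ℂ) ≠ 0 := by exact_mod_cast (sub_pos.2 ht1).ne'
    have hseg := hext _ h1 _ h2 ⟨t, 1 - t, ht0, sub_pos.2 ht1, by ring, by
      ext y
      simp only [LinearMap.add_apply, LinearMap.smul_apply, LinearMap.comp_apply,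
        LinearMap.mulLeft_apply, Complex.real_smul, smul_eq_mul]
      rw [mul_inv_cancel_left₀ hne, mul_inv_cancel_left₀ hne', ← map_add, ← add_mul,
        add_sub_cancel, one_mul]⟩
    have := LinearMap.congr_fun hseg x
    simp only [LinearMap.smul_apply, LinearMap.comp_apply, LinearMap.mulLeft_apply,
      smul_eq_mul] at this
    rw [← this, ht, mul_inv_cancel_left₀ hne]
  have hsa (a : A) (ha : IsSelfAdjoint a) : φ (a * x) = φ a * φ x := by
    -- rescale `a` into the interval `[1/4, 3/4]`
    set r : ℝ := (4 * (‖a‖ + 1))⁻¹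
    have hr : 0 < r := by positivity
    set b : A := algebraMap ℝ A (1 / 2) + r • a
    have hra : ‖r • a‖ ≤ 1 / 4 := by
      rw [norm_smul, Real.norm_of_nonneg hr.le]
      simp only [r]
      rw [inv_mul_le_iff₀ (by positivity)]
      linarith
    have hrsa : IsSelfAdjoint (r • a) := (IsSelfAdjoint.all r).smul ha
    have hup : r • a ≤ algebraMap ℝ A (1 / 4) :=
      hrsa.le_algebraMap_norm_self.trans (algebraMap_mono A hra)
    have hlo : -algebraMap ℝ A (1 / 4) ≤ r • a :=
      (neg_le_neg (algebraMap_mono A hra)).trans hrsa.neg_algebraMap_norm_le_self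
    have hlow : algebraMap ℝ A (1 / 4) ≤ b := by
      have : algebraMap ℝ A (1 / 4) = algebraMap ℝ A (1 / 2) + -algebraMap ℝ A (1 / 4) := by
        rw [← map_neg, ← map_add]; norm_num
      rw [this]
      exact add_le_add_right hlo _
    have hhigh : algebraMap ℝ A (1 / 4) ≤ 1 - b := by
      have : algebraMap ℝ A (1 / 4) = 1 - (algebraMap ℝ A (1 / 2) + algebraMap ℝ A (1 / 4)) := by
        rw [← map_one (algebraMap ℝ A), ← map_add, ← map_sub]; norm_num
      rw [this]
      exact sub_le_sub_left (add_le_add_right hup _) 1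
    have hq : 0 ≤ algebraMap ℝ A (1 / 4) := algebraMap_nonneg A (by norm_num)
    have hφalg (c : ℝ) : φ (algebraMap ℝ A c) = c := by
      rw [Algebra.algebraMap_eq_smul_one, ← Complex.coe_smul, map_smul, hφs.2]
      simp
    have hφmono {c d : A} (h : c ≤ d) : φ c ≤ φ d := by
      simpa using hφs.1 _ (sub_nonneg.2 h)
    have hl := hφmono hlow
    have hh := hφmono hhigh
    rw [hφalg, Complex.le_def] at hl
    rw [hφalg, map_sub, hφs.2, Complex.le_def] at hh
    have hb : φ b = ((φ b).re : ℂ) := Complex.ext rfl (by simpa using hl.2.symm)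
    have hcore := core b (hq.trans hlow) (hq.trans hhigh) (φ b).re hb
      (by have := hl.1; simp at this; linarith) (by have := hh.1; simp at this; linarith) x
    simp only [b, add_mul, map_add, hφalg, ← Algebra.smul_def, ← Complex.coe_smul, map_smul,
      smul_mul_assoc, smul_eq_mul] at hcore
    have hrc : (r : ℂ) ≠ 0 := by exact_mod_cast hr.ne'
    have := add_left_cancel hcore
    rw [mul_assoc] at this
    exact mul_left_cancel₀ hrc this
  have h := realPart_add_I_smul_imaginaryPart a
  rw [← h, add_mul, smul_mul_assoc, map_add, map_add, map_smul, map_smul, hsa _ (realPart a).2,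
    hsa _ (imaginaryPart a).2]
  simp only [smul_eq_mul]
  ring

/-- A pure `σ`-state is a point of the Gelfand `σ`-spectrum: extremality makes it multiplicative. -/
theorem IsPureSigmaState.exists_sigmaSpec {φ : A →ₗ[ℂ] ℂ} (hφ : IsPureSigmaState φ) :
    ∃ ψ : SigmaSpec A, ∀ a, ψ.toHom a = φ a := by
  have hs : φ ∈ states A := hφ.1.1
  let ψ : A →⋆ₐ[ℂ] ℂ :=
    { toFun := φ
      map_one' := hs.2
      map_mul' := map_mul_of_mem_extremePoints hφ.1
      map_zero' := map_zero φ
      map_add' := map_add φ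
      commutes' := fun r => by
        rw [Algebra.algebraMap_eq_smul_one, map_smul, hs.2]
        simp
      map_star' := map_star_of_mem_states hs }
  exact ⟨⟨ψ, hφ.2⟩, fun _ => rfl⟩

end PureStates

/-! ### The Gelfand transform of a purely `σ`-representable algebra -/

section Surjectivity

variable {A : Type*} [CommCStarAlgebra A] [PartialOrder A] [StarOrderedRing A]

theorem gelfand_injective (hA : IsPurelySigmaRepresentable A) :
    Function.Injective (gelfand A).toHom := by
  rw [injective_iff_map_eq_zero]
  intro a ha
  rw [← CStarRing.star_mul_self_eq_zero_iff]
  refine hA _ (star_mul_self_nonneg a) fun φ hφ => ?_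
  obtain ⟨ψ, hψ⟩ := hφ.exists_sigmaSpec
  rw [← hψ, map_mul, ← gelfand_apply a ψ, ha, Linf.zero_apply, mul_zero]

theorem SigmaSpec.map_cfc (φ : SigmaSpec A) {h : ℂ → ℂ} (hh : Continuous h) (a : A) :
    φ.toHom (cfc h a) = h (φ.toHom a) := by
  have hcont : Continuous φ.toHom := map_continuous φ.toHom
  rw [StarAlgHom.map_cfc φ.toHom h a hh.continuousOn hcont
    (inferInstanceAs (IsStarNormal a)) (inferInstanceAs (IsStarNormal (φ.toHom a)))]
  exact cfc_algebraMap (φ.toHom a) h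

/-- An injective Gelfand transform reflects positivity, since then `a` coincides with its absolute
value. -/
theorem nonneg_of_gelfand_nonneg (hinj : Function.Injective (gelfand A).toHom) {a : A}
    (h : ∀ φ : SigmaSpec A, 0 ≤ φ.toHom a) : 0 ≤ a := by
  have hc : Continuous fun z : ℂ => (‖z‖ : ℂ) := by fun_prop
  have ha : cfc (fun z : ℂ => (‖z‖ : ℂ)) a = a := by
    refine hinj (Linf.ext fun φ => ?_)
    rw [gelfand_apply, gelfand_apply, φ.map_cfc hc]
    exact Complex.norm_of_nonneg' (h φ)
  rw [← ha]
  exact cfc_nonneg fun z _ => by simp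

/-- A real function on the `σ`-spectrum is representable if it is evaluation at some element. -/
def IsRepresentable (f : SigmaSpec A → ℝ) : Prop :=
  ∃ a : A, ∀ φ : SigmaSpec A, φ.toHom a = f φ

namespace IsRepresentable

theorem const (c : ℝ) : IsRepresentable fun _ : SigmaSpec A => c :=
  ⟨algebraMap ℂ A c, fun φ => by rw [AlgHomClass.commutes]; simp⟩

theorem add {f g : SigmaSpec A → ℝ} (hf : IsRepresentable f) (hg : IsRepresentable g) :
    IsRepresentable fun φ => f φ + g φ := by
  obtain ⟨a, ha⟩ := hf
  obtain ⟨b, hb⟩ := hg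
  exact ⟨a + b, fun φ => by simp [ha, hb]⟩

theorem sub {f g : SigmaSpec A → ℝ} (hf : IsRepresentable f) (hg : IsRepresentable g) :
    IsRepresentable fun φ => f φ - g φ := by
  obtain ⟨a, ha⟩ := hf
  obtain ⟨b, hb⟩ := hg
  exact ⟨a - b, fun φ => by simp [ha, hb]⟩

theorem mul {f g : SigmaSpec A → ℝ} (hf : IsRepresentable f) (hg : IsRepresentable g) :
    IsRepresentable fun φ => f φ * g φ := by
  obtain ⟨a, ha⟩ := hf
  obtain ⟨b, hb⟩ := hg
  exact ⟨a * b, fun φ => by simp [ha, hb]⟩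

theorem comp_apply (a : A) {h : ℂ → ℝ} (hh : Continuous h) :
    IsRepresentable fun φ : SigmaSpec A => h (φ.toHom a) :=
  ⟨cfc (fun z => (h z : ℂ)) a, fun φ => φ.map_cfc (Complex.continuous_ofReal.comp hh) a⟩

/-- Representable functions are closed under bounded monotone pointwise limits: the lifted sequence
is increasing and bounded, so it has a supremum, which all `σ`-homomorphisms preserve. -/
theorem of_isLUB (hA : IsSigmaCStar A) (hinj : Function.Injective (gelfand A).toHom)
    {f : ℕ → SigmaSpec A → ℝ} (hf : ∀ n, IsRepresentable (f n)) (hmono : Monotone f) {C : ℝ}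
    (h0 : ∀ n φ, 0 ≤ f n φ) (hC : ∀ n φ, f n φ ≤ C) {g : SigmaSpec A → ℝ}
    (hg : ∀ φ, IsLUB (Set.range fun n => f n φ) (g φ)) : IsRepresentable g := by
  choose a ha using hf
  have hpos (n) : 0 ≤ a n := nonneg_of_gelfand_nonneg hinj fun φ => by
    rw [ha]
    exact_mod_cast h0 n φ
  have hinc : IsBddIncreasing a :=
    { selfAdjoint := fun n => IsSelfAdjoint.of_nonneg (hpos n)
      le_succ := fun n => by
        refine sub_nonneg.1 (nonneg_of_gelfand_nonneg hinj fun φ => ?_)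
        rw [map_sub, ha, ha, sub_nonneg]
        exact_mod_cast hmono n.le_succ φ
      bounded := by
        refine ⟨max C 0, fun n => ?_⟩
        rw [← NonUnitalStarAlgHom.norm_map (gelfand A).toHom hinj]
        refine Linf.norm_le (le_max_right _ _) fun φ => ?_
        rw [gelfand_apply, ha, Complex.norm_of_nonneg (h0 n φ)]
        exact (hC n φ).trans (le_max_left _ _) }
  obtain ⟨s, hs⟩ := hA a hinc
  refine ⟨s, fun φ => (φ.sigmaNormal a s hinc hs).unique ⟨⟨Complex.conj_ofReal _, fun n => ?_⟩,
    fun t ht => ?_⟩⟩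
  · refine (ha n φ).trans_le ?_
    exact_mod_cast (hg φ).1 ⟨n, rfl⟩
  · rw [Complex.le_def]
    refine ⟨(hg φ).2 ?_, (Complex.conj_eq_iff_im.1 ht.1).symm⟩
    rintro _ ⟨n, rfl⟩
    simpa [ha] using (Complex.le_def.1 (ht.2 n)).1

theorem indicator_iUnion (hA : IsSigmaCStar A)
    (hinj : Function.Injective (gelfand A).toHom)
    {S : ℕ → Set (SigmaSpec A)}
    (hS : ∀ n, IsRepresentable ((S n).indicator 1)) :
    IsRepresentable ((⋃ n, S n).indicator 1) := by
  classical
  have hacc (n) : IsRepresentable ((Set.accumulate S n).indicator 1) := by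
    induction n with
    | zero => simpa using hS 0
    | succ n ih =>
      convert (ih.add (hS (n + 1))).sub (ih.mul (hS (n + 1))) using 2 with φ
      rw [Set.accumulate_succ]
      by_cases h1 : φ ∈ Set.accumulate S n <;> by_cases h2 : φ ∈ S (n + 1) <;>
        simp [h1, h2]
  refine of_isLUB hA hinj hacc (C := 1) (fun m n hmn => ?_) (fun n φ => ?_) (fun n φ => ?_)
    fun φ => ?_
  · exact Set.indicator_le_indicator_of_subset (Set.monotone_accumulate hmn) fun _ => zero_le_one
  · exact Set.indicator_nonneg (fun _ _ => zero_le_one) φ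
  · exact Set.indicator_le' (fun _ _ => le_rfl) (fun _ _ => zero_le_one) φ
  · rw [← Set.iUnion_accumulate]
    refine ⟨?_, fun t ht => ?_⟩
    · rintro _ ⟨n, rfl⟩
      exact Set.indicator_le_indicator_of_subset (Set.subset_iUnion _ n) (fun _ => zero_le_one) φ
    · by_cases h : φ ∈ ⋃ n, Set.accumulate S n
      · obtain ⟨n, hn⟩ := Set.mem_iUnion.1 h
        refine le_trans ?_ (ht ⟨n, rfl⟩)
        simp only [Set.indicator_of_mem h, Set.indicator_of_mem hn, le_refl]
      · rw [Set.indicator_of_notMem h]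
        exact le_trans (Set.indicator_nonneg (fun _ _ => zero_le_one) φ) (ht ⟨0, rfl⟩)

/-- The indicator of the preimage of an open set `U` is the increasing limit of the functions
`min 1 (n * dist(·, Uᶜ))` of an evaluation. -/
theorem indicator_preimage_isOpen (hA : IsSigmaCStar A)
    (hinj : Function.Injective (gelfand A).toHom) (a : A) {U : Set ℂ} (hU : IsOpen U) :
    IsRepresentable ({φ : SigmaSpec A | φ.toHom a ∈ U}.indicator 1) := by
  have hmem (φ : SigmaSpec A) (h : φ.toHom a ∈ U) :
      {φ : SigmaSpec A | φ.toHom a ∈ U}.indicator (1 : SigmaSpec A → ℝ) φ = 1 :=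
    Set.indicator_of_mem (s := {φ : SigmaSpec A | φ.toHom a ∈ U}) h _
  have hnot (φ : SigmaSpec A) (h : φ.toHom a ∉ U) :
      {φ : SigmaSpec A | φ.toHom a ∈ U}.indicator (1 : SigmaSpec A → ℝ) φ = 0 :=
    Set.indicator_of_notMem (s := {φ : SigmaSpec A | φ.toHom a ∈ U}) h _
  -- the distance to the empty set has junk value `0`
  rcases Set.eq_empty_or_nonempty Uᶜ with hne | hne
  · rw [Set.compl_empty_iff] at hne
    convert const (A := A) 1 using 2 with φ
    exact hmem φ (by simp [hne])
  have hd (z) : 0 ≤ Metric.infDist z Uᶜ := Metric.infDist_nonneg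
  have hcont (n : ℕ) : Continuous fun z : ℂ => min 1 (n * Metric.infDist z Uᶜ) := by
    have := Metric.continuous_infDist_pt Uᶜ
    fun_prop
  refine of_isLUB hA hinj (fun n => comp_apply a (hcont n)) (C := 1) (fun m n hmn φ => ?_)
    (fun n φ => ?_) (fun n φ => min_le_left _ _) fun φ => ⟨?_, fun t ht => ?_⟩
  · have : (m : ℝ) ≤ n := by exact_mod_cast hmn
    have := hd (φ.toHom a)
    dsimp only
    gcongr
  · have := hd (φ.toHom a)
    positivity
  · rintro _ ⟨n, rfl⟩
    by_cases h : φ.toHom a ∈ U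
    · rw [hmem φ h]
      exact min_le_left _ _
    · rw [hnot φ h]
      simp [Metric.infDist_zero_of_mem (show φ.toHom a ∈ Uᶜ from h)]
  · by_cases h : φ.toHom a ∈ U
    · rw [hmem φ h]
      have hpos : 0 < Metric.infDist (φ.toHom a) Uᶜ :=
        (hU.isClosed_compl.notMem_iff_infDist_pos hne).1 (not_not.2 h)
      obtain ⟨n, hn⟩ := exists_nat_ge (1 / Metric.infDist (φ.toHom a) Uᶜ)
      rw [div_le_iff₀ hpos] at hn
      have := ht ⟨n, rfl⟩
      simpa [min_eq_left hn] using this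
    · rw [hnot φ h]
      have := ht ⟨0, rfl⟩
      simpa using this

theorem indicator (hA : IsSigmaCStar A)
    (hinj : Function.Injective (gelfand A).toHom)
    {S : Set (SigmaSpec A)} (hS : MeasurableSet S) :
    IsRepresentable (S.indicator 1) := by
  classical
  let m : MeasurableSpace (SigmaSpec A) :=
    { MeasurableSet' := fun S => IsRepresentable (S.indicator 1)
      measurableSet_empty := by simpa using const (A := A) 0
      measurableSet_compl := fun S h => by
        convert (const 1).sub h using 2 with φ
        by_cases hφ : φ ∈ S <;> simp [hφ]
      measurableSet_iUnion := fun S h => indicator_iUnion hA hinj h }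
  have hle : instMeasurableSpaceSigmaSpec A ≤ m := by
    refine iSup_le fun a => MeasurableSpace.comap_le_iff_le_map.2 ?_
    exact MeasurableSpace.generateFrom_le fun U hU => indicator_preimage_isOpen hA hinj a hU
  exact hle S hS

theorem toReal (hA : IsSigmaCStar A)
    (hinj : Function.Injective (gelfand A).toHom)
    {f : SigmaSpec A → ℝ≥0∞} (hf : Measurable f) :
    (∃ C : ℝ≥0∞, C ≠ ∞ ∧ ∀ φ, f φ ≤ C) → IsRepresentable fun φ => (f φ).toReal := by
  refine Measurable.ennreal_induction (motive := fun f => (∃ C : ℝ≥0∞, C ≠ ∞ ∧ ∀ φ, f φ ≤ C) →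
    IsRepresentable fun φ => (f φ).toReal) ?_ ?_ ?_ hf
  · intro c S hS _
    convert (const c.toReal).mul (indicator hA hinj hS) using 2 with φ
    by_cases hφ : φ ∈ S <;> simp [hφ]
  · rintro f g - - - hf hg ⟨C, hC, h⟩
    have hfC (φ) : f φ ≤ C := le_self_add.trans (h φ)
    have hgC (φ) : g φ ≤ C := le_add_self.trans (h φ)
    convert (hf ⟨C, hC, hfC⟩).add (hg ⟨C, hC, hgC⟩) using 2 with φ
    exact ENNReal.toReal_add (ne_top_of_le_ne_top hC (hfC φ)) (ne_top_of_le_ne_top hC (hgC φ))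
  · rintro f - hmono hf ⟨C, hC, h⟩
    have hfC (n φ) : f n φ ≤ C := (le_iSup (fun n => f n φ) n).trans (h φ)
    have hfin (n φ) : f n φ ≠ ∞ := ne_top_of_le_ne_top hC (hfC n φ)
    refine of_isLUB hA hinj (fun n => hf n ⟨C, hC, hfC n⟩) (C := C.toReal) (fun m n hmn φ => ?_)
      (fun n φ => ENNReal.toReal_nonneg) (fun n φ => ENNReal.toReal_mono hC (hfC n φ)) fun φ => ?_
    · exact ENNReal.toReal_mono (hfin n φ) (hmono hmn φ)
    · rw [ENNReal.toReal_iSup fun n => hfin n φ]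
      exact isLUB_ciSup ⟨C.toReal, by
        rintro _ ⟨n, rfl⟩
        exact ENNReal.toReal_mono hC (hfC n φ)⟩

theorem of_measurable (hA : IsSigmaCStar A)
    (hinj : Function.Injective (gelfand A).toHom)
    {f : SigmaSpec A → ℝ} (hf : Measurable f) {C : ℝ} (hC : ∀ φ, |f φ| ≤ C) :
    IsRepresentable f := by
  have h1 := toReal hA hinj (f := fun φ => ENNReal.ofReal (f φ)) hf.ennreal_ofReal
    ⟨ENNReal.ofReal C, ENNReal.ofReal_ne_top, fun φ =>
      ENNReal.ofReal_le_ofReal ((le_abs_self _).trans (hC φ))⟩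
  have h2 := toReal hA hinj (f := fun φ => ENNReal.ofReal (-f φ)) hf.neg.ennreal_ofReal
    ⟨ENNReal.ofReal C, ENNReal.ofReal_ne_top, fun φ =>
      ENNReal.ofReal_le_ofReal ((neg_le_abs _).trans (hC φ))⟩
  convert h1.sub h2 using 2 with φ
  rw [ENNReal.toReal_ofReal', ENNReal.toReal_ofReal']
  exact (max_zero_sub_max_neg_zero_eq_self _).symm

end IsRepresentable

theorem gelfand_surjective (hA : IsSigmaCStar A)
    (hinj : Function.Injective (gelfand A).toHom) :
    Function.Surjective (gelfand A).toHom := by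
  intro f
  obtain ⟨a, ha⟩ := IsRepresentable.of_measurable hA hinj
    (Complex.measurable_re.comp f.measurable) (C := ‖f‖)
    fun φ => (Complex.abs_re_le_norm _).trans (f.norm_apply_le φ)
  obtain ⟨b, hb⟩ := IsRepresentable.of_measurable hA hinj
    (Complex.measurable_im.comp f.measurable) (C := ‖f‖)
    fun φ => (Complex.abs_im_le_norm _).trans (f.norm_apply_le φ)
  refine ⟨a + Complex.I • b, Linf.ext fun φ => ?_⟩
  rw [gelfand_apply, map_add, map_smul, ha, hb, smul_eq_mul, mul_comm]
  exact Complex.re_add_im (f φ)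

/-- A bijective `σ`-homomorphism has an inverse `σ`-homomorphism, being an order isomorphism. -/
theorem SigmaHom.exists_inverse {B C : Type*} [CStarAlgebra B] [PartialOrder B] [StarOrderedRing B]
    [CStarAlgebra C] [PartialOrder C] [StarOrderedRing C] (f : SigmaHom B C)
    (hf : Function.Bijective f.toHom) :
    ∃ g : SigmaHom C B, g.comp f = SigmaHom.id B ∧ f.comp g = SigmaHom.id C := by
  let e : B ≃⋆ₐ[ℂ] C := StarAlgEquiv.ofBijective f.toHom hf
  have he (b : B) : e b = f.toHom b := rfl
  let g : C →⋆ₐ[ℂ] B := (e.symm : C →⋆ₐ[ℂ] B)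
  have hgf (b : B) : g (f.toHom b) = b := e.symm_apply_apply b
  have hfg (c : C) : f.toHom (g c) = c := e.apply_symm_apply c
  refine ⟨⟨g, fun a s ha hs => ⟨⟨hs.1.1.map g, fun n => OrderHomClass.mono g (hs.1.2 n)⟩,
    fun t ht => ?_⟩⟩, SigmaHom.ext (StarAlgHom.ext hgf), SigmaHom.ext (StarAlgHom.ext hfg)⟩
  have h : s ≤ f.toHom t := hs.2 ⟨ht.1.map f.toHom, fun n => by
    rw [← hfg (a n)]
    exact OrderHomClass.mono f.toHom (ht.2 n)⟩
  rw [← hgf t]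
  exact OrderHomClass.mono g h

end Surjectivity

/-! ### The adjunction -/

/-- Evaluation at points, as a measurable map `X → Spec (L^∞ X)` natural in `X`. -/
def evalNatTrans : 𝟭 MeasCat.{u} ⟶ LinfFunctor.{u}.rightOp ⋙ SigmaSpecFunctor.{u} where
  app _ := ⟨Linf.eval, Linf.measurable_eval⟩
  naturality _ _ _ := rfl

/-- The Gelfand transform `A → L^∞(Spec A)`, natural in `A`, as a morphism of the opposite
category. -/
def gelfandNatTrans : SigmaSpecFunctor.{u} ⋙ LinfFunctor.{u}.rightOp ⟶ 𝟭 CSigmaCStar.{u}ᵒᵖ where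
  app A := Quiver.Hom.op (show A.unop ⟶ LinfFunctor.obj (.op (SigmaSpecFunctor.obj A)) from
    gelfand A.unop.carrier)
  naturality _ _ _ := rfl

/-- The adjunction whose unit is evaluation at points and whose counit is the Gelfand transform. -/
def gelfandAdjunction : LinfFunctor.{u}.rightOp ⊣ SigmaSpecFunctor.{u} :=
  Adjunction.mkOfUnitCounit
    { unit := evalNatTrans
      counit := gelfandNatTrans
      left_triangle := rfl
      right_triangle := rfl }

theorem isIso_map_gelfandNatTrans (A : CSigmaCStar.{u}ᵒᵖ) :
    IsIso (SigmaSpecFunctor.map (gelfandNatTrans.app A)) :=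
  ⟨evalNatTrans.app (SigmaSpecFunctor.obj A),
    Subtype.ext (funext fun Φ => eval_comp_gelfand (A := A.unop.carrier) Φ), rfl⟩

theorem isIdempotentAdjunction_gelfandAdjunction :
    IsIdempotentAdjunction gelfandAdjunction.{u} := by
  have (X : MeasCat.{u}) : IsIso (gelfandAdjunction.{u}.toMonad.μ.app X) :=
    isIso_map_gelfandNatTrans (LinfFunctor.rightOp.obj X)
  exact NatIso.isIso_of_isIso_app _

/-- The points of `X` already provide enough pure `σ`-states on `L^∞(X)`. -/
theorem isPureRep_linf (X : MeasCat.{u}) : IsPureRep (LinfFunctor.obj (.op X)) :=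
  fun _ _ h => Linf.ext (X := X) fun x => h _ (Linf.eval x).isPureSigmaState

theorem isIso_evalNatTrans {X : MeasCat.{u}} (hX : IsSober X) : IsIso (evalNatTrans.app X) := by
  obtain ⟨g, hg, h1, h2⟩ := exists_inverse_eval hX
  exact ⟨⟨g, hg⟩, Subtype.ext (funext h1), Subtype.ext (funext h2)⟩

theorem isIso_gelfand {A : CSigmaCStar.{u}} (hA : IsPureRep A) :
    IsIso (gelfandNatTrans.app (.op A)).unop := by
  have hinj := gelfand_injective hA
  obtain ⟨g, h1, h2⟩ :=
    (gelfand A.carrier).exists_inverse ⟨hinj, gelfand_surjective A.isSigma hinj⟩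
  exact ⟨g, h1, h2⟩

end

end MeasGelfand

open CategoryTheory MeasGelfand in
theorem theorem4p27 :
    ∃ adj : LinfFunctor.{u}.rightOp ⊣ SigmaSpecFunctor.{u},
      IsIdempotentAdjunction adj ∧
      ∃ (hL : ∀ X : MeasCat.{u}, IsSober X → IsPureRep (LinfFunctor.obj (.op X)))
        (hS : ∀ A : CSigmaCStar.{u}, IsPureRep A → IsSober (SigmaSpecFunctor.obj (.op A)))
        (η : 𝟭 SobMeas.{u} ≅ (LinfRestrict hL).rightOp ⋙ SigmaSpecRestrict hS)
        (ε : SigmaSpecRestrict hS ⋙ (LinfRestrict hL).rightOp ≅ 𝟭 CPureRep.{u}ᵒᵖ),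
        (∀ X : SobMeas.{u}, (η.hom.app X).hom = adj.unit.app X.obj) ∧
        (∀ A : CPureRep.{u}, (ε.hom.app (.op A)).unop.hom = (adj.counit.app (.op A.obj)).unop) := by
  refine ⟨gelfandAdjunction, isIdempotentAdjunction_gelfandAdjunction,
    fun X _ => isPureRep_linf X, fun A _ => isSober_sigmaSpec A,
    NatIso.ofComponents (fun X => IsSober.isoMk
      (@asIso _ _ _ _ (evalNatTrans.app X.obj) (isIso_evalNatTrans X.property)))
      fun _ => rfl,
    NatIso.ofComponents (fun A => Iso.op (IsPureRep.isoMk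
      (@asIso _ _ _ _ (gelfandNatTrans.app (.op A.unop.obj)).unop
        (isIso_gelfand A.unop.property))))
      fun _ => rfl, fun _ => rfl, fun _ => rfl⟩
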